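/- Let $\Sigma$ be a semigroup and let $A:\Sigma\to\mathfrak{gl}(W)$ be a representation of $\Sigma$ in a finite-dimensional real vector space $W$, i.e. a map with $A_{\sigma\tau}=A_\sigma\circ A_\tau$ for all $\sigma,\tau\in\Sigma$. A subspace is a subrepresentation if it is stable under all $A_\sigma$; a representation is indecomposable if it is nonzero and is not the direct sum of two nonzero subrepresentations. Write $\mathrm{End}(W)$ for the real algebra of linear maps $L:W\to W$ with $L\circ A_\sigma=A_\sigma\circ L$ for all $\sigma\in\Sigma$. If $W$ is indecomposable, its nilpotent elements form a two-sided ideal $\mathrm{End}^{\mathrm{Nil}}(W)$, and $W$ is called absolutely indecomposable (of real type) if it is indecomposable and $\mathrm{End}(W)/\mathrm{End}^{\mathrm{Nil}}(W)\cong\mathbb R$. For $L\in\mathrm{End}(W)$ let $L^S$ be the semisimple part of $L$ (so $L=L^S+L^N$ with $L^S$ semisimple, $L^N$ nilpotent, and $L^SL^N=L^NL^S$); the generalized kernel $\ker L^S$ is a subrepresentation. Let $a<b$ be real numbers and consider the space of all continuously differentiable one-parameter families $L:(a,b)\to\mathrm{End}(W)$, with the strong (Whitney) $C^1$ topology: a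 set $\mathcal U$ of families is open if for every $L\in\mathcal U$ there is a continuous function $\delta:(a,b)\to(0,\infty)$ such that $\mathcal U$ contains every family $M$ with $\|M(\lambda)-L(\lambda)\|<\delta(\lambda)$ and $\|M'(\lambda)-L'(\lambda)\|<\delta(\lambda)$ for all $\lambda\in(a,b)$. (The choice of norm is immaterial.) A family $L$ is in general position if for every $\lambda\in(a,b)$ either $L(\lambda)$ is invertible or the generalized kernel $\ker L(\lambda)^S$ is absolutely indecomposable. **Theorem.** Suppose that $W=W_1\oplus\dots\oplus W_m$ is a direct sum of mutually non-isomorphic indecomposable subrepresentations. Then the set of one-parameter families $L:(a,b)\to\mathrm{End}(W)$ in general position is open and dense in the strong $C^1$ topology. -/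

import Mathlib

noncomputable section

/-- A representation of the semigroup `S` in the real vector space `W`: a map
`s ↦ A s` into the linear maps of `W` with `A (s * t) = A s ∘ A t`. If `S` happens to have a unit,
it is not required to act as the identity. -/
abbrev SemigroupRep (S W : Type*) [Semigroup S] [AddCommGroup W] [Module ℝ W] :=
  S →ₙ* Module.End ℝ W

namespace SemigroupRep

section Algebraic

variable {S W W' : Type*} [Semigroup S] [AddCommGroup W] [Module ℝ W]
  [AddCommGroup W'] [Module ℝ W']

/-- A subspace is a subrepresentation if it is stable under the action of the semigroup. -/
def IsSubrep (A : SemigroupRep S W) (U : Submodule ℝ W) : Prop :=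
  ∀ s, ∀ w ∈ U, A s w ∈ U

/-- The representation in a subrepresentation, by restriction. -/
def restrict (A : SemigroupRep S W) (U : Submodule ℝ W) (hU : A.IsSubrep U) :
    SemigroupRep S U where
  toFun s := (A s).restrict (hU s)
  map_mul' s t := by
    ext w
    simp [LinearMap.restrict_apply]

/-- A representation is indecomposable if it is nonzero and is not the direct sum of two nonzero
subrepresentations. -/
def Indecomposable (A : SemigroupRep S W) : Prop :=
  Nontrivial W ∧ ∀ U V : Submodule ℝ W, A.IsSubrep U → A.IsSubrep V → IsCompl U V →
    U = ⊥ ∨ V = ⊥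

/-- Isomorphism of representations: an invertible homomorphism of representations. -/
def IsIsomorphic (A : SemigroupRep S W) (B : SemigroupRep S W') : Prop :=
  ∃ e : W ≃ₗ[ℝ] W', ∀ s w, e (A s w) = B s (e w)

/-- `End(W)`: the real algebra of all linear maps that commute with the action. -/
def endo (A : SemigroupRep S W) : Subalgebra ℝ (Module.End ℝ W) where
  carrier := {L | ∀ s, L * A s = A s * L}
  mul_mem' {L M} hL hM s := by rw [mul_assoc, hM s, ← mul_assoc, hL s, mul_assoc]
  add_mem' {L M} hL hM s := by rw [add_mul, mul_add, hL s, hM s]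
  algebraMap_mem' r s := Algebra.commutes r (A s)

theorem mem_endo {A : SemigroupRep S W} {L : Module.End ℝ W} :
    L ∈ A.endo ↔ ∀ s, L * A s = A s * L := Iff.rfl

theorem endo_apply {A : SemigroupRep S W} {L : Module.End ℝ W} (hL : L ∈ A.endo) (s : S) (w : W) :
    L (A s w) = A s (L w) := LinearMap.congr_fun (hL s) w

theorem isSubrep_ker {A : SemigroupRep S W} {L : Module.End ℝ W} (hL : L ∈ A.endo) :
    A.IsSubrep (LinearMap.ker L) := by
  intro s w hw
  rw [LinearMap.mem_ker] at hw ⊢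
  rw [endo_apply hL, hw, map_zero]

theorem isSubrep_range {A : SemigroupRep S W} {L : Module.End ℝ W} (hL : L ∈ A.endo) :
    A.IsSubrep (LinearMap.range L) := by
  rintro s _ ⟨w, rfl⟩
  exact ⟨A s w, endo_apply hL s w⟩

variable [FiniteDimensional ℝ W]

/-- An endomorphism of an indecomposable representation is invertible or nilpotent. -/
theorem Indecomposable.isUnit_or_isNilpotent {A : SemigroupRep S W} (h : A.Indecomposable)
    (L : A.endo) : IsUnit L ∨ IsNilpotent L := by
  obtain ⟨n, hn, hn1⟩ :=
    ((LinearMap.eventually_isCompl_ker_pow_range_pow (L : Module.End ℝ W)).and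
      (Filter.eventually_ge_atTop 1)).exists
  have hp : (L : Module.End ℝ W) ^ n ∈ A.endo := pow_mem L.2 n
  rcases h.2 _ _ (isSubrep_ker hp) (isSubrep_range hp) hn with h1 | h1
  · left
    have hu : IsUnit ((L : Module.End ℝ W) ^ n) := (LinearMap.isUnit_iff_ker_eq_bot _).2 h1
    obtain ⟨u, hu⟩ := (isUnit_pow_iff (by omega)).1 hu
    have hmem : ((u⁻¹ : (Module.End ℝ W)ˣ) : Module.End ℝ W) ∈ A.endo := by
      intro s
      have hs : (u : Module.End ℝ W) * A s = A s * u := by rw [hu]; exact L.2 s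
      rw [Units.inv_mul_eq_iff_eq_mul, ← mul_assoc, hs, mul_assoc, Units.mul_inv, mul_one]
    refine ⟨⟨L, ⟨_, hmem⟩, ?_, ?_⟩, rfl⟩
    · apply Subtype.ext
      simp [← hu]
    · apply Subtype.ext
      simp [← hu]
  · right
    refine ⟨n, Subtype.ext ?_⟩
    simpa using LinearMap.range_eq_bot.1 h1

theorem Indecomposable.isNilpotent_of_not_isUnit {A : SemigroupRep S W} (h : A.Indecomposable)
    {L : A.endo} (hL : ¬ IsUnit L) : IsNilpotent L :=
  (h.isUnit_or_isNilpotent L).resolve_left hL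

theorem Indecomposable.mul_ne_one_left {A : SemigroupRep S W} (h : A.Indecomposable)
    {L : A.endo} (hL : IsNilpotent L) (M : A.endo) : M * L ≠ 1 := by
  have := h.1
  obtain ⟨n, hn⟩ := hL
  intro hM
  have : ∀ k : ℕ, M ^ k * L ^ k = 1 := by
    intro k
    induction k with
    | zero => simp
    | succ k ih =>
      rw [pow_succ, pow_succ', mul_assoc, ← mul_assoc M, hM, one_mul, ih]
  have h1 := this n
  rw [hn, mul_zero] at h1
  exact zero_ne_one h1

theorem Indecomposable.mul_ne_one_right {A : SemigroupRep S W} (h : A.Indecomposable)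
    {L : A.endo} (hL : IsNilpotent L) (M : A.endo) : L * M ≠ 1 := by
  have := h.1
  obtain ⟨n, hn⟩ := hL
  intro hM
  have : ∀ k : ℕ, L ^ k * M ^ k = 1 := by
    intro k
    induction k with
    | zero => simp
    | succ k ih =>
      rw [pow_succ, pow_succ', mul_assoc, ← mul_assoc L, hM, one_mul, ih]
  have h1 := this n
  rw [hn, zero_mul] at h1
  exact zero_ne_one h1

theorem Indecomposable.isNilpotent_mul_left {A : SemigroupRep S W} (h : A.Indecomposable)
    {L M : A.endo} (hM : IsNilpotent M) : IsNilpotent (L * M) := by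
  apply h.isNilpotent_of_not_isUnit
  rintro ⟨u, hu⟩
  apply h.mul_ne_one_left hM (↑u⁻¹ * L)
  rw [mul_assoc, ← hu, Units.inv_mul]

theorem Indecomposable.isNilpotent_mul_right {A : SemigroupRep S W} (h : A.Indecomposable)
    {L M : A.endo} (hL : IsNilpotent L) : IsNilpotent (L * M) := by
  apply h.isNilpotent_of_not_isUnit
  rintro ⟨u, hu⟩
  apply h.mul_ne_one_right hL (M * ↑u⁻¹)
  rw [← mul_assoc, ← hu, Units.mul_inv]

theorem Indecomposable.isNilpotent_add {A : SemigroupRep S W} (h : A.Indecomposable)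
    {L M : A.endo} (hL : IsNilpotent L) (hM : IsNilpotent M) : IsNilpotent (L + M) := by
  apply h.isNilpotent_of_not_isUnit
  rintro ⟨u, hu⟩
  have h1 : (↑u⁻¹ * L : A.endo) = 1 - ↑u⁻¹ * M := by
    rw [eq_sub_iff_add_eq, ← mul_add, ← hu, Units.inv_mul]
  have h2 : IsUnit (1 - ↑u⁻¹ * M : A.endo) := (h.isNilpotent_mul_left hM).isUnit_one_sub
  rw [← h1] at h2
  obtain ⟨v, hv⟩ := h2
  apply h.mul_ne_one_left hL (↑v⁻¹ * ↑u⁻¹)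
  rw [mul_assoc, ← hv, Units.inv_mul]

/-- `End^Nil(W)`: the two-sided ideal of all nilpotent endomorphisms of an indecomposable
representation. -/
def nilIdeal (A : SemigroupRep S W) (h : A.Indecomposable) : TwoSidedIdeal A.endo :=
  TwoSidedIdeal.mk' {L | IsNilpotent L} IsNilpotent.zero
    (fun hL hM => h.isNilpotent_add hL hM) (fun hL => hL.neg)
    (fun hM => h.isNilpotent_mul_left hM) (fun hL => h.isNilpotent_mul_right hL)

/-- A representation is absolutely indecomposable (of real type) if it is indecomposable and
`End(W) / End^Nil(W)` is isomorphic to `ℝ` as a real algebra. -/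
def AbsolutelyIndecomposable (A : SemigroupRep S W) : Prop :=
  ∃ h : A.Indecomposable, Nonempty ((A.nilIdeal h).ringCon.Quotient ≃ₐ[ℝ] ℝ)

/-- The semisimple part `L^S` in the (unique) decomposition `L = L^S + L^N` of a linear map into
commuting semisimple and nilpotent parts. -/
def semisimplePart (L : Module.End ℝ W) : Module.End ℝ W :=
  L.exists_isNilpotent_isSemisimple.choose_spec.2.choose

theorem semisimplePart_spec (L : Module.End ℝ W) :
    semisimplePart L ∈ Algebra.adjoin ℝ {L} ∧ (semisimplePart L).IsSemisimple ∧
      IsNilpotent (L - semisimplePart L) := by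
  have h := L.exists_isNilpotent_isSemisimple.choose_spec
  obtain ⟨h1, h2, h3, h4⟩ := h.2.choose_spec
  refine ⟨h1, h3, ?_⟩
  have h5 : L - semisimplePart L = L.exists_isNilpotent_isSemisimple.choose :=
    sub_eq_of_eq_add h4
  rw [h5]
  exact h2

/-- The generalized kernel `ker L^S`. -/
def genKer (L : Module.End ℝ W) : Submodule ℝ W := LinearMap.ker (semisimplePart L)

theorem isSubrep_genKer {A : SemigroupRep S W} {L : Module.End ℝ W} (hL : L ∈ A.endo) :
    A.IsSubrep (genKer L) :=
  isSubrep_ker (Algebra.adjoin_le (Set.singleton_subset_iff.2 hL) (semisimplePart_spec L).1)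

end Algebraic

section Families

variable {S W : Type*} [Semigroup S] [NormedAddCommGroup W] [NormedSpace ℝ W]

/-- A continuously differentiable one-parameter family `L : (a, b) → End(W)`. The curve is stored
as a function on `ℝ` that vanishes outside the open interval `(a, b)`, so that two families are
equal exactly if they agree on `(a, b)`; nothing is required at the end points. -/
@[ext]
structure C1Family (A : SemigroupRep S W) (a b : ℝ) where
  toFun : ℝ → W →L[ℝ] W
  contDiffOn : ContDiffOn ℝ 1 toFun (Set.Ioo a b)
  mem_endo : ∀ t ∈ Set.Ioo a b, (toFun t : Module.End ℝ W) ∈ A.endo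
  eq_zero : ∀ t ∉ Set.Ioo a b, toFun t = 0

/-- The basic neighbourhood of the family `L` for the (strong) `C^1` topology that is given by a
function `δ` on `(a, b)`: all families that are pointwise `δ`-close to `L` together with their
first derivative. -/
def C1Family.nhd {A : SemigroupRep S W} {a b : ℝ} (L : C1Family A a b) (δ : ℝ → ℝ) :
    Set (C1Family A a b) :=
  {M | ∀ t ∈ Set.Ioo a b, ‖M.toFun t - L.toFun t‖ < δ t ∧
    ‖deriv M.toFun t - deriv L.toFun t‖ < δ t}

/-- The strong (Whitney) `C^1` topology on the space of one-parameter families: the neighbourhoods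
of `L` are the sets that contain some `L.nhd δ` with `δ` continuous and positive on `(a, b)`. -/
instance C1Family.instTopologicalSpace (A : SemigroupRep S W) (a b : ℝ) :
    TopologicalSpace (C1Family A a b) where
  IsOpen U := ∀ L ∈ U, ∃ δ : ℝ → ℝ, ContinuousOn δ (Set.Ioo a b) ∧
    (∀ t ∈ Set.Ioo a b, 0 < δ t) ∧ L.nhd δ ⊆ U
  isOpen_univ := fun _ _ => ⟨fun _ => 1, continuousOn_const, fun _ _ => one_pos,
    Set.subset_univ _⟩
  isOpen_inter := by
    rintro U V hU hV L ⟨hLU, hLV⟩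
    obtain ⟨δ, hδ, hδ0, hδU⟩ := hU L hLU
    obtain ⟨ε, hε, hε0, hεV⟩ := hV L hLV
    refine ⟨fun t => min (δ t) (ε t), hδ.inf hε, fun t ht => lt_min (hδ0 t ht) (hε0 t ht), ?_⟩
    intro M hM
    exact ⟨hδU fun t ht => ⟨(hM t ht).1.trans_le (min_le_left _ _),
        (hM t ht).2.trans_le (min_le_left _ _)⟩,
      hεV fun t ht => ⟨(hM t ht).1.trans_le (min_le_right _ _),
        (hM t ht).2.trans_le (min_le_right _ _)⟩⟩
  isOpen_sUnion := by
    rintro 𝒰 h𝒰 L ⟨U, hU, hLU⟩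
    obtain ⟨δ, hδ, hδ0, hδU⟩ := h𝒰 U hU L hLU
    exact ⟨δ, hδ, hδ0, hδU.trans (Set.subset_sUnion_of_mem hU)⟩

/-- A family is in general position if for every parameter value in `(a, b)`, either `L(t)` is
invertible or the generalized kernel of `L(t)` is absolutely indecomposable. -/
def C1Family.InGeneralPosition [FiniteDimensional ℝ W] {A : SemigroupRep S W} {a b : ℝ}
    (L : C1Family A a b) : Prop :=
  ∀ t (ht : t ∈ Set.Ioo a b),
    IsUnit (L.toFun t : Module.End ℝ W) ∨
      (A.restrict (genKer (L.toFun t : Module.End ℝ W))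
        (isSubrep_genKer (L.mem_endo t ht))).AbsolutelyIndecomposable

end Families

end SemigroupRep

end

/-!
The families in general position are those that avoid a finite union of subspaces of codimension at
least two in `End(W)`.

*Algebra.* Let `N i ⊆ End(W)` be the set of endomorphisms whose diagonal block at the summand `W i`
is nilpotent (`Decomposition.blockNil`). Because the summands are indecomposable and mutually
non-isomorphic, the passage to a diagonal block is multiplicative modulo nilpotents, and `N i` is a
completely prime ideal (`Decomposition.isCompletelyPrime_blockNil`): the quotient is the division
algebra `End(W i) / End^Nil(W i)`. An idempotent that lies in all `N i` is zero, since its rank is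
its trace, which is the sum of the traces of its nilpotent diagonal blocks
(`Decomposition.eq_zero_of_forall_mem_blockNil`). It follows that a direct summand of `W` with
idempotent `e` is indecomposable exactly if `e ∉ N i` for a single `i`, and then it is absolutely
indecomposable exactly if `End(W) = N i + ℝ`
(`Decomposition.absolutelyIndecomposable_iff_existsUnique`).
Let `e` be the idempotent of the generalized kernel of `L`. As `L e` is nilpotent and `L + e` is
invertible, `L ∈ N i` if and only if `e ∉ N i`. So `L` violates the condition of general position
exactly if it lies in some `N i ⊓ N j` with `i ≠ j`, or in some `N i` that is not of real type
(`Decomposition.isUnit_or_absolutelyIndecomposable_genKer_iff`). These subspaces have codimension at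
least two (`Decomposition.finrank_inf_add_two_le`).

*Analysis.* A finite union `Z` of subspaces is closed, and the distance of `L t` to `Z` is a function
`δ` whose neighbourhood of `L` consists of families that avoid `Z`
(`C1Family.isOpen_setOf_forall_notMem`). For density, let `δ` be given, and choose a `C^1` function
`ρ > 0` such that `ρ` and its derivative are below `δ` (`exists_contDiff_pos_lt`). The family
`L + ρ • c` with a constant `c` of norm less than one is in the `δ`-neighbourhood of `L`. It meets a
subspace `Y` only if `c` is in the image of a `C^1` map from `Y × (a, b)` to `End(W)`; if `Y` has
codimension at least two, then the dimension of this image is less than that of `End(W)`, so that the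
set of all other `c` is dense (`exists_forall_add_smul_notMem`).
-/

namespace SemigroupRep

/-! ### Completely prime ideals -/

/-- A proper two-sided ideal `N` of a real algebra, given as a subspace, such that a product lies
in `N` only if one of its factors does; in other words, the quotient has no zero divisors. -/
structure IsCompletelyPrime {E : Type*} [Ring E] [Algebra ℝ E] (N : Submodule ℝ E) : Prop where
  mul_left : ∀ x {y}, y ∈ N → x * y ∈ N
  mul_right : ∀ {x} y, x ∈ N → x * y ∈ N
  one_notMem : (1 : E) ∉ N
  mem_or_mem : ∀ {x y}, x * y ∈ N → x ∈ N ∨ y ∈ N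

namespace IsCompletelyPrime

variable {E : Type*} [Ring E] [Algebra ℝ E] {N : Submodule ℝ E}

theorem mem_of_isNilpotent (h : IsCompletelyPrime N) {x : E} (hx : IsNilpotent x) : x ∈ N := by
  obtain ⟨n, hn⟩ := hx
  have key : ∀ k : ℕ, x ^ k ∈ N → x ∈ N := by
    intro k
    induction k with
    | zero => intro h0; rw [pow_zero] at h0; exact absurd h0 h.one_notMem
    | succ k ih =>
      intro hk
      rw [pow_succ] at hk
      exact (h.mem_or_mem hk).elim ih id
  exact key n (hn ▸ N.zero_mem)

theorem notMem_of_isUnit (h : IsCompletelyPrime N) {x : E} (hx : IsUnit x) : x ∉ N := by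
  rintro hN
  obtain ⟨u, rfl⟩ := hx
  apply h.one_notMem
  rw [← u.mul_inv]
  exact h.mul_right _ hN

end IsCompletelyPrime

/-! ### Units and nilpotents among the endomorphisms -/

section Units

variable {S W : Type*} [Semigroup S] [AddCommGroup W] [Module ℝ W]

theorem isUnit_endo_iff {A : SemigroupRep S W} (x : A.endo) :
    IsUnit x ↔ IsUnit (x : Module.End ℝ W) := by
  refine ⟨fun h => h.map A.endo.val, ?_⟩
  rintro ⟨u, hu⟩
  have hmem : ((u⁻¹ : (Module.End ℝ W)ˣ) : Module.End ℝ W) ∈ A.endo := by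
    intro s
    have hs : (u : Module.End ℝ W) * A s = A s * u := by rw [hu]; exact x.2 s
    rw [Units.inv_mul_eq_iff_eq_mul, ← mul_assoc, hs, mul_assoc, Units.mul_inv, mul_one]
  refine ⟨⟨x, ⟨_, hmem⟩, ?_, ?_⟩, rfl⟩ <;> apply Subtype.ext <;> simp [← hu]

theorem isNilpotent_endo_iff {A : SemigroupRep S W} (x : A.endo) :
    IsNilpotent x ↔ IsNilpotent (x : Module.End ℝ W) :=
  (IsNilpotent.map_iff (f := A.endo.val) Subtype.val_injective).symm

end Units

/-! ### Retracts of representations -/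

section Retracts

variable {S W V : Type*} [Semigroup S] [AddCommGroup W] [Module ℝ W] [AddCommGroup V] [Module ℝ V]

/-- A way of exhibiting `B` as a direct summand of `A`: homomorphisms of representations
`incl : B → A` and `proj : A → B` with `proj ∘ incl = id`. -/
structure Retract (A : SemigroupRep S W) (B : SemigroupRep S V) where
  /-- The embedding of the summand. -/
  incl : V →ₗ[ℝ] W
  /-- The projection to the summand. -/
  proj : W →ₗ[ℝ] V
  incl_map : ∀ s v, incl (B s v) = A s (incl v)
  proj_map : ∀ s w, proj (A s w) = B s (proj w)
  proj_incl : ∀ v, proj (incl v) = v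

namespace Retract

variable {A : SemigroupRep S W} {B : SemigroupRep S V} (r : Retract A B)

/-- The compression `y ↦ proj ∘ y ∘ incl` of endomorphisms to a direct summand. -/
def compress : A.endo →ₗ[ℝ] B.endo where
  toFun y := ⟨r.proj ∘ₗ y.1 ∘ₗ r.incl, fun s => by
    ext v
    simp [r.incl_map, r.proj_map, endo_apply y.2]⟩
  map_add' x y := by ext; simp
  map_smul' c x := by ext; simp

/-- The extension by zero `x ↦ incl ∘ x ∘ proj` of endomorphisms of a direct summand. -/
def extend : B.endo →ₗ[ℝ] A.endo where
  toFun x := ⟨r.incl ∘ₗ x.1 ∘ₗ r.proj, fun s => by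
    ext v
    simp [r.incl_map, r.proj_map, endo_apply x.2]⟩
  map_add' x y := by ext; simp
  map_smul' c x := by ext; simp

/-- The idempotent endomorphism that projects onto a direct summand. -/
def idem : A.endo := r.extend 1

theorem compress_apply (y : A.endo) (v : V) :
    (r.compress y : Module.End ℝ V) v = r.proj ((y : Module.End ℝ W) (r.incl v)) := rfl

theorem extend_apply (x : B.endo) (w : W) :
    (r.extend x : Module.End ℝ W) w = r.incl ((x : Module.End ℝ V) (r.proj w)) := rfl

theorem idem_apply (w : W) : (r.idem : Module.End ℝ W) w = r.incl (r.proj w) := rfl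

theorem extend_mul (x y : B.endo) : r.extend (x * y) = r.extend x * r.extend y := by
  ext w
  simp [extend_apply, r.proj_incl]

theorem idem_mul_extend (x : B.endo) : r.idem * r.extend x = r.extend x := by
  rw [idem, ← extend_mul, one_mul]

theorem extend_mul_idem (x : B.endo) : r.extend x * r.idem = r.extend x := by
  rw [idem, ← extend_mul, mul_one]

theorem idem_mul_idem : r.idem * r.idem = r.idem := r.idem_mul_extend 1

theorem compress_extend (x : B.endo) : r.compress (r.extend x) = x := by
  ext v
  simp [compress_apply, extend_apply, r.proj_incl]

theorem compress_one : r.compress 1 = 1 := by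
  ext v
  simp [compress_apply, r.proj_incl]

theorem extend_compress (y : A.endo) : r.extend (r.compress y) = r.idem * y * r.idem := by
  ext w
  simp [extend_apply, compress_apply, idem_apply]

theorem extend_injective : Function.Injective r.extend :=
  Function.LeftInverse.injective r.compress_extend

theorem isNilpotent_extend {x : B.endo} (hx : IsNilpotent x) : IsNilpotent (r.extend x) := by
  obtain ⟨n, hn⟩ := hx
  have h : ∀ k : ℕ, r.extend x ^ (k + 1) = r.extend (x ^ (k + 1)) := by
    intro k
    induction k with
    | zero => simp
    | succ k ih => rw [pow_succ, ih, ← extend_mul, ← pow_succ]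
  refine ⟨n + 1, ?_⟩
  rw [h, pow_succ, hn, zero_mul, map_zero]

theorem idem_ne_zero [Nontrivial V] : r.idem ≠ 0 := by
  obtain ⟨v, hv⟩ := exists_ne (0 : V)
  intro h
  have h1 : (r.idem : Module.End ℝ W) (r.incl v) = 0 := by rw [h]; rfl
  rw [idem_apply, r.proj_incl] at h1
  exact hv (by rw [← r.proj_incl v, h1, map_zero])

end Retract

/-- A subrepresentation with a complementary subrepresentation is a retract. -/
noncomputable def retractOfIsCompl (A : SemigroupRep S W) {K R : Submodule ℝ W} (hK : A.IsSubrep K)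
    (hR : A.IsSubrep R) (h : IsCompl K R) : Retract A (A.restrict K hK) where
  incl := K.subtype
  proj := K.projectionOnto R h
  incl_map _ _ := rfl
  proj_map s w := by
    have hw := Submodule.projection_add_projection_eq_self h w
    conv_lhs => rw [← hw, map_add, map_add]
    rw [Submodule.projectionOnto_apply_of_mem_left h (hK s _ (Submodule.projection_apply_mem h w)),
      (Submodule.projectionOnto_apply_eq_zero_iff h).2
        (hR s _ (Submodule.projection_apply_mem h.symm w)), add_zero]
    rfl
  proj_incl v := Submodule.projectionOnto_apply_left h v

/-- A composition of homomorphisms `V → V' → V` between non-isomorphic indecomposable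
representations is nilpotent: otherwise `V` would be a direct summand of `V'`. -/
theorem isNilpotent_of_factors {V' : Type*} [AddCommGroup V'] [Module ℝ V']
    [FiniteDimensional ℝ V] {B : SemigroupRep S V} {B' : SemigroupRep S V'}
    (hB : B.Indecomposable) (hB' : B'.Indecomposable) (hn : ¬ B.IsIsomorphic B')
    (f : V →ₗ[ℝ] V') (hf : ∀ s v, f (B s v) = B' s (f v))
    (g : V' →ₗ[ℝ] V) (hg : ∀ s v, g (B' s v) = B s (g v))
    (x : B.endo) (hx : (x : Module.End ℝ V) = g ∘ₗ f) : IsNilpotent x := by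
  apply hB.isNilpotent_of_not_isUnit
  intro hu
  rw [isUnit_endo_iff, Module.End.isUnit_iff, hx] at hu
  have hfi : Function.Injective f := Function.Injective.of_comp hu.1
  have hc : IsCompl (LinearMap.range f) (LinearMap.ker g) := by
    constructor
    · rw [Submodule.disjoint_def]
      rintro _ ⟨v, rfl⟩ hv
      have : v = 0 := hu.1 (by simpa using hv)
      rw [this, map_zero]
    · rw [codisjoint_iff, Submodule.eq_top_iff']
      intro w
      obtain ⟨v, hv⟩ := hu.2 (g w)
      refine Submodule.mem_sup.2 ⟨f v, ⟨v, rfl⟩, w - f v, ?_, by abel⟩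
      rw [LinearMap.mem_ker, map_sub, ← hv]
      simp
  have hr : B'.IsSubrep (LinearMap.range f) := by
    rintro s _ ⟨v, rfl⟩
    exact ⟨B s v, hf s v⟩
  have hk : B'.IsSubrep (LinearMap.ker g) := by
    intro s w hw
    rw [LinearMap.mem_ker] at hw ⊢
    rw [hg, hw, map_zero]
  rcases hB'.2 _ _ hr hk hc with h | h
  · have := hB.1
    obtain ⟨v, hv⟩ := exists_ne (0 : V)
    apply hv
    apply hfi
    rw [map_zero]
    exact LinearMap.congr_fun (LinearMap.range_eq_bot.1 h) v
  · rw [h] at hc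
    have hs : Function.Surjective f := LinearMap.range_eq_top.1 (eq_top_of_isCompl_bot hc)
    exact hn ⟨LinearEquiv.ofBijective f ⟨hfi, hs⟩, hf⟩

end Retracts

/-! ### Decompositions into indecomposable representations -/

section Decompositions

/-- A decomposition of the representation `A` into a finite direct sum of representations `B i`. -/
structure Decomposition {S W ι : Type*} [Semigroup S] [AddCommGroup W] [Module ℝ W] [Fintype ι]
    {V : ι → Type*} [∀ i, AddCommGroup (V i)] [∀ i, Module ℝ (V i)]
    (A : SemigroupRep S W) (B : ∀ i, SemigroupRep S (V i)) where
  /-- The individual summands. -/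
  retract : ∀ i, Retract A (B i)
  proj_incl_of_ne : ∀ {i j}, i ≠ j → ∀ v, (retract i).proj ((retract j).incl v) = 0
  sum_incl_proj : ∀ w, ∑ i, (retract i).incl ((retract i).proj w) = w

/-- The decomposition given by an internal direct sum of subrepresentations. -/
noncomputable def Decomposition.ofIsInternal {S W ι : Type*} [Semigroup S] [AddCommGroup W]
    [Module ℝ W] [Fintype ι] [DecidableEq ι] (A : SemigroupRep S W) (U : ι → Submodule ℝ W)
    (hU : ∀ i, A.IsSubrep (U i)) (hsum : DirectSum.IsInternal U) :
    Decomposition A (fun i => A.restrict (U i) (hU i)) :=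
  let π : ∀ i, W →ₗ[ℝ] U i := fun i => DirectSum.component ℝ ι (fun i => U i) i ∘ₗ
    (LinearEquiv.ofBijective (DirectSum.coeLinearMap U) hsum).symm.toLinearMap
  have hπ : ∀ i (v : U i), π i v = v := fun i v => hsum.ofBijective_coeLinearMap_same v
  have hπ' : ∀ {i j}, i ≠ j → ∀ v : U j, π i v = 0 :=
    fun hij v => hsum.ofBijective_coeLinearMap_of_ne hij.symm v
  have hs : ∀ w, ∑ i, (π i w : W) = w := fun w => by
    classical
    refine Eq.trans ?_ ((LinearEquiv.ofBijective (DirectSum.coeLinearMap U) hsum).apply_symm_apply w)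
    refine Eq.trans ?_ (DirectSum.coeLinearMap_eq_dfinsuppSum U _).symm
    exact (DFinsupp.sum_eq_sum_fintype _ fun _ => rfl).symm
  { retract := fun i =>
      { incl := (U i).subtype
        proj := π i
        incl_map := fun _ _ => rfl
        proj_map := fun s w => by
          conv_lhs => rw [← hs w, map_sum, map_sum]
          rw [Finset.sum_eq_single i]
          · exact hπ i ⟨_, hU i s _ (π i w).2⟩
          · intro j _ hj
            exact hπ' hj.symm ⟨_, hU j s _ (π j w).2⟩
          · intro h
            exact absurd (Finset.mem_univ i) h
        proj_incl := hπ i }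
    proj_incl_of_ne := hπ'
    sum_incl_proj := hs }

namespace Decomposition

variable {S W ι : Type*} [Semigroup S] [AddCommGroup W] [Module ℝ W] [Fintype ι]
  {V : ι → Type*} [∀ i, AddCommGroup (V i)] [∀ i, Module ℝ (V i)] [∀ i, FiniteDimensional ℝ (V i)]
  {A : SemigroupRep S W} {B : ∀ i, SemigroupRep S (V i)} (D : Decomposition A B)
  (hB : ∀ i, (B i).Indecomposable)

/-- The endomorphisms whose diagonal block at an indecomposable summand is nilpotent. -/
def blockNil (i : ι) : Submodule ℝ A.endo where
  carrier := {x | IsNilpotent ((D.retract i).compress x)}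
  zero_mem' := by
    rw [Set.mem_ofPred_eq, map_zero]
    exact IsNilpotent.zero
  add_mem' hx hy := by
    rw [Set.mem_ofPred_eq, map_add]
    exact (hB i).isNilpotent_add hx hy
  smul_mem' c x hx := by
    rw [Set.mem_ofPred_eq, map_smul]
    exact hx.smul c

theorem mem_blockNil {i : ι} {x : A.endo} :
    x ∈ D.blockNil hB i ↔ IsNilpotent ((D.retract i).compress x) := Iff.rfl

/-- If the summands are mutually non-isomorphic, then the passage to a diagonal block is
multiplicative modulo nilpotents: the other terms of the matrix product factor through a
non-isomorphic summand. -/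
theorem isNilpotent_compress_mul_sub (hB : ∀ i, (B i).Indecomposable)
    (hn : ∀ i j, i ≠ j → ¬ (B i).IsIsomorphic (B j)) (i : ι) (x y : A.endo) :
    IsNilpotent ((D.retract i).compress (x * y) -
      (D.retract i).compress x * (D.retract i).compress y) := by
  classical
  have h : (D.retract i).compress (x * y) - (D.retract i).compress x * (D.retract i).compress y =
      ∑ k ∈ Finset.univ.erase i, (D.retract i).compress (x * (D.retract k).idem * y) := by
    rw [sub_eq_iff_eq_add]
    have h1 : (D.retract i).compress x * (D.retract i).compress y =
        (D.retract i).compress (x * (D.retract i).idem * y) := by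
      ext v
      simp [Retract.compress_apply, Retract.idem_apply]
    rw [h1, Finset.sum_erase_add _ _ (Finset.mem_univ i), ← map_sum]
    congr 1
    ext w
    simp only [MulMemClass.coe_mul, Module.End.mul_apply, AddSubmonoidClass.coe_finsetSum,
      LinearMap.sum_apply, Retract.idem_apply, ← map_sum, D.sum_incl_proj]
  rw [h]
  refine Finset.sum_induction _ IsNilpotent (fun _ _ => (hB i).isNilpotent_add) .zero ?_
  intro k hk
  refine isNilpotent_of_factors (hB i) (hB k) (hn i k (Finset.ne_of_mem_erase hk).symm)
    ((D.retract k).proj ∘ₗ y.1 ∘ₗ (D.retract i).incl) ?_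
    ((D.retract i).proj ∘ₗ x.1 ∘ₗ (D.retract k).incl) ?_ _ rfl
  · intro s v
    simp [Retract.incl_map, Retract.proj_map, endo_apply y.2]
  · intro s v
    simp [Retract.incl_map, Retract.proj_map, endo_apply x.2]

theorem isCompletelyPrime_blockNil (hn : ∀ i j, i ≠ j → ¬ (B i).IsIsomorphic (B j)) (i : ι) :
    IsCompletelyPrime (D.blockNil hB i) := by
  have key : ∀ x y, x * y ∈ D.blockNil hB i ↔
      IsNilpotent ((D.retract i).compress x * (D.retract i).compress y) := by
    intro x y
    have h := D.isNilpotent_compress_mul_sub hB hn i x y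
    rw [mem_blockNil]
    constructor
    · intro h1
      have h2 := (hB i).isNilpotent_add h1 h.neg
      rwa [← sub_eq_add_neg, sub_sub_cancel] at h2
    · intro h1
      have h2 := (hB i).isNilpotent_add h h1
      rwa [sub_add_cancel] at h2
  have := (hB i).1
  refine ⟨fun x y hy => (key x y).2 ((hB i).isNilpotent_mul_left hy),
    fun y hx => (key _ y).2 ((hB i).isNilpotent_mul_right hx), ?_, ?_⟩
  · rw [mem_blockNil, Retract.compress_one]
    exact not_isNilpotent_one
  · intro x y hxy
    rw [key] at hxy
    by_contra! hc
    have h1 := ((hB i).isUnit_or_isNilpotent _).resolve_right hc.1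
    have h2 := ((hB i).isUnit_or_isNilpotent _).resolve_right hc.2
    exact hxy.not_isUnit (h1.mul h2)

theorem idem_mem_blockNil {i j : ι} (hij : i ≠ j) :
    (D.retract j).idem ∈ D.blockNil hB i := by
  have h : (D.retract i).compress (D.retract j).idem = 0 := by
    ext v
    simp [Retract.compress_apply, Retract.idem_apply, D.proj_incl_of_ne hij]
  rw [mem_blockNil, h]
  exact .zero

theorem idem_notMem_blockNil (i : ι) : (D.retract i).idem ∉ D.blockNil hB i := by
  have := (hB i).1
  rw [mem_blockNil, Retract.idem, Retract.compress_extend]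
  exact not_isNilpotent_one

/-- An idempotent whose diagonal blocks are all nilpotent vanishes: its rank is its trace, which is
the sum of the traces of the diagonal blocks. -/
theorem eq_zero_of_forall_mem_blockNil [FiniteDimensional ℝ W] {e : A.endo} (he : e * e = e)
    (h : ∀ i, e ∈ D.blockNil hB i) : e = 0 := by
  have htr : LinearMap.trace ℝ W e = 0 := by
    have h1 : (e : Module.End ℝ W) =
        ∑ i, (D.retract i).incl ∘ₗ ((D.retract i).proj ∘ₗ (e : Module.End ℝ W)) := by
      ext w
      simp [LinearMap.sum_apply, D.sum_incl_proj]
    rw [h1, map_sum]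
    refine Finset.sum_eq_zero fun i _ => ?_
    rw [LinearMap.trace_comp_comm']
    have h2 := (isNilpotent_endo_iff _).1 (h i)
    exact (LinearMap.isNilpotent_trace_of_isNilpotent h2).eq_zero
  have hid : IsIdempotentElem (e : Module.End ℝ W) := congrArg Subtype.val he
  have hr := (LinearMap.IsIdempotentElem.isProj_range _ hid).trace
  rw [htr] at hr
  have h0 : Module.finrank ℝ (LinearMap.range (e : Module.End ℝ W)) = 0 := by exact_mod_cast hr.symm
  exact Subtype.ext (LinearMap.range_eq_bot.1 (Submodule.finrank_eq_zero.1 h0))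

end Decomposition

end Decompositions


/-! ### Absolute indecomposability of direct summands -/

section RealType

/-- A subspace `N` of a real algebra, typically a completely prime ideal, is of real type if it
and the scalars span the algebra. -/
def IsRealType {E : Type*} [Ring E] [Algebra ℝ E] (N : Submodule ℝ E) : Prop :=
  ∀ x : E, ∃ c : ℝ, x - algebraMap ℝ E c ∈ N

variable {S W V : Type*} [Semigroup S] [AddCommGroup W] [Module ℝ W] [AddCommGroup V] [Module ℝ V]

theorem mem_nilIdeal [FiniteDimensional ℝ V] {B : SemigroupRep S V} (h : B.Indecomposable)
    (x : B.endo) : x ∈ B.nilIdeal h ↔ IsNilpotent x :=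
  TwoSidedIdeal.mem_mk' ..

theorem absolutelyIndecomposable_iff [FiniteDimensional ℝ V] {B : SemigroupRep S V} :
    B.AbsolutelyIndecomposable ↔
      B.Indecomposable ∧ ∀ x : B.endo, ∃ c : ℝ, IsNilpotent (x - algebraMap ℝ B.endo c) := by
  have key : ∀ (h : B.Indecomposable) (x : B.endo) (c : ℝ),
      ((x : (B.nilIdeal h).ringCon.Quotient) = algebraMap ℝ _ c) ↔
        IsNilpotent (x - algebraMap ℝ B.endo c) := by
    intro h x c
    rw [← mem_nilIdeal h, ← TwoSidedIdeal.rel_iff, ← RingCon.eq]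
    rfl
  constructor
  · rintro ⟨h, ⟨e⟩⟩
    refine ⟨h, fun x => ⟨e x, (key h x _).1 ?_⟩⟩
    apply e.injective
    rw [AlgEquiv.commutes]
    rfl
  · rintro ⟨h, hx⟩
    refine ⟨h, ⟨(AlgEquiv.ofBijective
      (Algebra.ofId ℝ (B.nilIdeal h).ringCon.Quotient) ⟨?_, ?_⟩).symm⟩⟩
    · have := h.1
      have : Nontrivial (B.nilIdeal h).ringCon.Quotient := by
        refine ⟨1, 0, fun h1 => ?_⟩
        have h2 := (key h 1 0).1 (by rw [map_zero]; exact h1)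
        rw [map_zero, sub_zero] at h2
        exact not_isNilpotent_one h2
      exact (Algebra.ofId ℝ _).toRingHom.injective
    · intro q
      induction q using Quotient.inductionOn' with
      | h x =>
        obtain ⟨c, hc⟩ := hx x
        exact ⟨c, ((key h x c).2 hc).symm⟩

end RealType

section Summands

variable {S W V' ι : Type*} [Semigroup S] [AddCommGroup W] [Module ℝ W]
  [AddCommGroup V'] [Module ℝ V'] [Fintype ι]
  {V : ι → Type*} [∀ i, AddCommGroup (V i)] [∀ i, Module ℝ (V i)] [∀ i, FiniteDimensional ℝ (V i)]
  {A : SemigroupRep S W} {B : ∀ i, SemigroupRep S (V i)} (D : Decomposition A B)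
  {C : SemigroupRep S V'}

namespace Decomposition

/-- A direct summand is indecomposable only if its idempotent is nonzero modulo exactly one of the
ideals `blockNil`: if there were two, then a projection to a summand, compressed to `C`, would be
neither invertible nor nilpotent. -/
theorem existsUnique_of_indecomposable
    [FiniteDimensional ℝ W] [FiniteDimensional ℝ V']
    (hB : ∀ i, (B i).Indecomposable) (hn : ∀ i j, i ≠ j → ¬ (B i).IsIsomorphic (B j))
    (r : Retract A C) (hC : C.Indecomposable) :
    ∃! i, r.idem ∉ D.blockNil hB i := by
  have := hC.1
  have hex : ∃ i, r.idem ∉ D.blockNil hB i := by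
    by_contra! h
    exact r.idem_ne_zero (D.eq_zero_of_forall_mem_blockNil hB r.idem_mul_idem h)
  obtain ⟨i, hi⟩ := hex
  refine ⟨i, hi, fun j hj => ?_⟩
  by_contra hji
  have hPi := D.isCompletelyPrime_blockNil hB hn i
  have hPj := D.isCompletelyPrime_blockNil hB hn j
  have hext := r.extend_compress (D.retract i).idem
  rcases hC.isUnit_or_isNilpotent (r.compress (D.retract i).idem) with h | h
  · obtain ⟨u, hu⟩ := h
    apply hj
    rw [Retract.idem, ← u.mul_inv, Retract.extend_mul, hu, hext]
    exact hPj.mul_right _ (hPj.mul_right _ (hPj.mul_left _ (D.idem_mem_blockNil hB hji)))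
  · have h1 := hPi.mem_of_isNilpotent (r.isNilpotent_extend h)
    rw [hext] at h1
    exact (hPi.mem_or_mem h1).elim
      (fun h2 => (hPi.mem_or_mem h2).elim hi (D.idem_notMem_blockNil hB i)) hi

/-- If the idempotent of a summand `C` is nonzero modulo only one of the ideals `blockNil`, then
of two complementary idempotents below it one lies in all of these ideals and is therefore zero. -/
theorem indecomposable_of_forall_ne
    [FiniteDimensional ℝ W]
    (hB : ∀ i, (B i).Indecomposable) (hn : ∀ i j, i ≠ j → ¬ (B i).IsIsomorphic (B j))
    (r : Retract A C) {i : ι} (hi : r.idem ∉ D.blockNil hB i)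
    (hj : ∀ j, j ≠ i → r.idem ∈ D.blockNil hB j) : C.Indecomposable := by
  have hP := D.isCompletelyPrime_blockNil hB hn
  have hzero : ∀ x : C.endo, x * x = x → r.extend x ∈ D.blockNil hB i → x = 0 := by
    intro x hx hxi
    apply r.extend_injective
    rw [map_zero]
    refine D.eq_zero_of_forall_mem_blockNil hB (by rw [← r.extend_mul, hx]) fun j => ?_
    by_cases hji : j = i
    · rwa [hji]
    · rw [← r.extend_mul_idem]
      exact (hP j).mul_left _ (hj j hji)
  refine ⟨?_, fun K R hK hR hKR => ?_⟩
  · by_contra h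
    rw [not_nontrivial_iff_subsingleton] at h
    apply hi
    have h1 : (1 : C.endo) = 0 := Subtype.ext (LinearMap.ext fun v => Subsingleton.elim _ _)
    rw [Retract.idem, h1, map_zero]
    exact Submodule.zero_mem _
  · -- The ideal contains the projection to `K` along `R` or the complementary projection.
    set q := (retractOfIsCompl C hK hR hKR).idem
    have hqq : q * q = q := Retract.idem_mul_idem _
    have h1 : r.extend q * r.extend (1 - q) ∈ D.blockNil hB i := by
      rw [← r.extend_mul, mul_sub, mul_one, hqq, sub_self, map_zero]
      exact Submodule.zero_mem _
    rcases (hP i).mem_or_mem h1 with h2 | h2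
    · left
      have h3 := hzero q hqq h2
      rw [Submodule.eq_bot_iff]
      intro v hv
      have h4 : (q : Module.End ℝ V') v = v := (Retract.idem_apply _ v).trans
        (congrArg Subtype.val (Submodule.projectionOnto_apply_left hKR ⟨v, hv⟩))
      rw [← h4, h3]
      rfl
    · right
      have h3 := hzero (1 - q) (by rw [mul_sub, sub_mul, sub_mul, hqq]; simp) h2
      rw [Submodule.eq_bot_iff]
      intro v hv
      have h4 : (q : Module.End ℝ V') v = 0 := (Retract.idem_apply _ v).trans
        (congrArg Subtype.val ((Submodule.projectionOnto_apply_eq_zero_iff hKR).2 hv))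
      rw [← h4, ← sub_eq_zero.1 h3]
      rfl

/-- For an indecomposable summand `C`, an endomorphism of `C` is nilpotent exactly if its extension
by zero lies in the ideal `blockNil` at which the idempotent of `C` is nonzero, so that `C` and the
ideal are of real type at the same time. -/
theorem absolutelyIndecomposable_iff_isRealType
    [FiniteDimensional ℝ V']
    (hB : ∀ i, (B i).Indecomposable) (hn : ∀ i j, i ≠ j → ¬ (B i).IsIsomorphic (B j))
    (r : Retract A C) (hC : C.Indecomposable) {i : ι}
    (hi : r.idem ∉ D.blockNil hB i) :
    C.AbsolutelyIndecomposable ↔ IsRealType (D.blockNil hB i) := by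
  have hP := D.isCompletelyPrime_blockNil hB hn i
  have key : ∀ x : C.endo, IsNilpotent x ↔ r.extend x ∈ D.blockNil hB i := by
    refine fun x => ⟨fun hx => hP.mem_of_isNilpotent (r.isNilpotent_extend hx), fun hx => ?_⟩
    refine (hC.isUnit_or_isNilpotent x).resolve_left ?_
    rintro ⟨u, rfl⟩
    apply hi
    rw [Retract.idem, ← u.mul_inv, Retract.extend_mul]
    exact hP.mul_right _ hx
  have hscalar : ∀ (x : C.endo) (c : ℝ), r.extend (x - algebraMap ℝ C.endo c) =
      r.extend x - c • r.idem := by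
    intro x c
    rw [map_sub, Algebra.algebraMap_eq_smul_one, map_smul]
    rfl
  rw [absolutelyIndecomposable_iff, and_iff_right hC]
  constructor
  · intro h y
    obtain ⟨c, hc⟩ := h (r.compress y)
    refine ⟨c, ?_⟩
    rw [key, hscalar, r.extend_compress] at hc
    have h1 : r.idem * (y - algebraMap ℝ A.endo c) * r.idem ∈ D.blockNil hB i := by
      rw [mul_sub, sub_mul, Algebra.algebraMap_eq_smul_one, mul_smul_comm, mul_one, smul_mul_assoc,
        r.idem_mul_idem]
      exact hc
    exact ((hP.mem_or_mem (((hP.mem_or_mem h1).resolve_right hi))).resolve_left hi)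
  · intro h x
    obtain ⟨c, hc⟩ := h (r.extend x)
    refine ⟨c, ?_⟩
    rw [key, hscalar]
    have h1 := hP.mul_left r.idem hc
    rwa [mul_sub, r.idem_mul_extend, Algebra.algebraMap_eq_smul_one, mul_smul_comm, mul_one] at h1

theorem absolutelyIndecomposable_iff_existsUnique
    [FiniteDimensional ℝ W] [FiniteDimensional ℝ V']
    (hB : ∀ i, (B i).Indecomposable) (hn : ∀ i j, i ≠ j → ¬ (B i).IsIsomorphic (B j))
    (r : Retract A C) :
    C.AbsolutelyIndecomposable ↔
      ∃ i, r.idem ∉ D.blockNil hB i ∧ (∀ j, j ≠ i → r.idem ∈ D.blockNil hB j) ∧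
        IsRealType (D.blockNil hB i) := by
  constructor
  · intro h
    obtain ⟨i, hi, hu⟩ := D.existsUnique_of_indecomposable hB hn r h.1
    exact ⟨i, hi, fun j hj => by_contra fun h1 => hj (hu j h1),
      (D.absolutelyIndecomposable_iff_isRealType hB hn r h.1 hi).1 h⟩
  · rintro ⟨i, hi, hj, hr⟩
    exact (D.absolutelyIndecomposable_iff_isRealType hB hn r
      (D.indecomposable_of_forall_ne hB hn r hi hj) hi).2 hr

end Decomposition

end Summands

/-! ### The generalized kernel -/

section GenKer

variable {S W ι : Type*} [Semigroup S] [AddCommGroup W] [Module ℝ W] [FiniteDimensional ℝ W]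

theorem isCompl_ker_range_of_isSemisimple {T : Module.End ℝ W} (hT : T.IsSemisimple) :
    IsCompl (LinearMap.ker T) (LinearMap.range T) := by
  rw [Submodule.isCompl_iff_disjoint _ _ (by rw [add_comm, LinearMap.finrank_range_add_finrank_ker]),
    Submodule.disjoint_def]
  rintro _ hv ⟨v, rfl⟩
  -- For a semisimple map the generalized eigenvectors are eigenvectors.
  have h := hT.isFinitelySemisimple.genEigenspace_eq_eigenspace 0 (k := 2) (by norm_num)
  have h1 : v ∈ T.genEigenspace 0 (2 : ℕ) := by
    rw [Module.End.mem_genEigenspace_nat, zero_smul, sub_zero, LinearMap.mem_ker, pow_two]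
    exact hv
  rw [Nat.cast_ofNat, h, Module.End.mem_eigenspace_iff, zero_smul] at h1
  exact h1

/-- The generalized kernel of `L` is a direct summand, and the corresponding idempotent is the one
of the Fitting decomposition: `L` is nilpotent on the generalized kernel, and adding the idempotent
makes `L` invertible. -/
theorem exists_retract_genKer {A : SemigroupRep S W} (L : A.endo) :
    ∃ r : Retract A (A.restrict (genKer (L : Module.End ℝ W)) (isSubrep_genKer L.2)),
      IsNilpotent (L * r.idem) ∧ IsUnit (L + r.idem) := by
  obtain ⟨hadj, hss, hnil⟩ := semisimplePart_spec (L : Module.End ℝ W)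
  set T := semisimplePart (L : Module.End ℝ W)
  have hTE : T ∈ A.endo := Algebra.adjoin_le (Set.singleton_subset_iff.2 L.2) hadj
  have hLT : Commute (L : Module.End ℝ W) T := Algebra.commute_of_mem_adjoin_self hadj
  have hc := isCompl_ker_range_of_isSemisimple hss
  let r : Retract A (A.restrict (genKer (L : Module.End ℝ W)) (isSubrep_genKer L.2)) :=
    retractOfIsCompl A (isSubrep_ker hTE) (isSubrep_range hTE) hc
  have hre : (r.idem : Module.End ℝ W) = Submodule.projection _ _ hc := rfl
  have hTe : T * r.idem = 0 := by
    ext w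
    rw [hre]
    exact LinearMap.mem_ker.1 (Submodule.projection_apply_mem hc w)
  have heT : (r.idem : Module.End ℝ W) * T = 0 := by
    ext w
    rw [hre]
    exact (Submodule.projection_apply_eq_zero_iff hc).2 ⟨w, rfl⟩
  -- The idempotent commutes with everything that preserves both the kernel and the range of `T`.
  have hcomm : Commute (L : Module.End ℝ W) r.idem := by
    have h1 : (r.idem : Module.End ℝ W) * (L * r.idem) = L * r.idem := by
      ext w
      rw [hre]
      refine (Submodule.projection_eq_self_iff hc _).2 (LinearMap.mem_ker.2 ?_)
      rw [← Module.End.mul_apply, ← mul_assoc, ← hLT.eq, mul_assoc, ← hre, hTe, mul_zero]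
      rfl
    have h2 : (r.idem : Module.End ℝ W) * (L * r.idem) = r.idem * L := by
      rw [← sub_eq_zero, ← mul_sub]
      ext w
      have hw : (r.idem : Module.End ℝ W) w - w ∈ LinearMap.range T := by
        rw [← neg_sub]
        exact Submodule.neg_mem _ (Submodule.sub_projection_mem hc w)
      obtain ⟨z, hz⟩ := hw
      have h3 : (L : Module.End ℝ W) ((r.idem : Module.End ℝ W) w) - (L : Module.End ℝ W) w =
          T ((L : Module.End ℝ W) z) := by
        rw [← map_sub, ← hz]
        exact LinearMap.congr_fun hLT.eq z
      simp only [Module.End.mul_apply, LinearMap.sub_apply, h3]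
      exact LinearMap.congr_fun heT _
    exact h1.symm.trans h2
  refine ⟨r, ?_, ?_⟩
  · rw [isNilpotent_endo_iff]
    have h : ((L * r.idem : A.endo) : Module.End ℝ W) = (L - T) * r.idem := by
      rw [sub_mul, hTe, sub_zero]
      rfl
    rw [h]
    refine Commute.isNilpotent_mul_right ?_ hnil
    rw [Commute, SemiconjBy, sub_mul, mul_sub, hTe, heT, hcomm.eq]
  · rw [isUnit_endo_iff]
    have h : ((L + r.idem : A.endo) : Module.End ℝ W) = (T + r.idem) + (L - T) := by
      push_cast
      abel
    rw [h]
    refine IsNilpotent.isUnit_add_left_of_commute hnil ?_ ?_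
    · rw [LinearMap.isUnit_iff_ker_eq_bot, LinearMap.ker_eq_bot']
      intro w hw
      have h1 : T w = 0 ∧ (r.idem : Module.End ℝ W) w = 0 := by
        have h2 : T w = -(r.idem : Module.End ℝ W) w := eq_neg_of_add_eq_zero_left hw
        have h3 : (r.idem : Module.End ℝ W) w = 0 := by
          have h4 := LinearMap.congr_fun heT w
          rw [Module.End.mul_apply, h2, map_neg, ← Module.End.mul_apply] at h4
          have h5 := congrArg (fun z : A.endo => (z : Module.End ℝ W) w) r.idem_mul_idem
          rw [← h5]
          simpa using h4
        exact ⟨by rw [h2, h3, neg_zero], h3⟩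
      have h2 : (r.idem : Module.End ℝ W) w = w := by
        rw [hre]
        exact (Submodule.projection_eq_self_iff hc w).2 h1.1
      rw [← h2, h1.2]
    · refine Commute.sub_left ?_ ?_
      · exact hLT.add_right hcomm
      · exact (Commute.refl T).add_right (by rw [Commute, SemiconjBy, hTe, heT])

variable [Fintype ι]
  {V : ι → Type*} [∀ i, AddCommGroup (V i)] [∀ i, Module ℝ (V i)] [∀ i, FiniteDimensional ℝ (V i)]
  {A : SemigroupRep S W} {B : ∀ i, SemigroupRep S (V i)} (D : Decomposition A B)

/-- The condition of general position at a single endomorphism `L` says that `L` lies in at most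
one of the ideals `blockNil`, and only in one of real type. -/
theorem Decomposition.isUnit_or_absolutelyIndecomposable_genKer_iff
    (hB : ∀ i, (B i).Indecomposable) (hn : ∀ i j, i ≠ j → ¬ (B i).IsIsomorphic (B j))
    (L : A.endo) :
    (IsUnit (L : Module.End ℝ W) ∨
      (A.restrict (genKer (L : Module.End ℝ W)) (isSubrep_genKer L.2)).AbsolutelyIndecomposable) ↔
    ∀ i j, (i ≠ j ∨ ¬ IsRealType (D.blockNil hB i)) →
      L ∉ D.blockNil hB i ⊓ D.blockNil hB j := by
  obtain ⟨r, hnil, hunit⟩ := exists_retract_genKer L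
  have hP := D.isCompletelyPrime_blockNil hB hn
  have key : ∀ i, L ∈ D.blockNil hB i ↔ r.idem ∉ D.blockNil hB i := by
    refine fun i => ⟨fun h1 h2 => (hP i).notMem_of_isUnit hunit (Submodule.add_mem _ h1 h2),
      fun h => ?_⟩
    exact ((hP i).mem_or_mem ((hP i).mem_of_isNilpotent hnil)).resolve_right h
  rw [← isUnit_endo_iff, D.absolutelyIndecomposable_iff_existsUnique hB hn r]
  constructor
  · rintro (h | ⟨i, hi, hj, hr⟩) k l hkl hL
    · exact (hP k).notMem_of_isUnit h hL.1
    · have hk : k = i := by_contra fun h => (key k).1 hL.1 (hj k h)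
      have hl : l = i := by_contra fun h => (key l).1 hL.2 (hj l h)
      subst hk
      exact hkl.elim (fun h => h hl.symm) (fun h => h hr)
  · intro h
    by_cases h0 : ∃ i, L ∈ D.blockNil hB i
    · obtain ⟨i, hi⟩ := h0
      refine Or.inr ⟨i, (key i).1 hi, fun j hj => ?_, ?_⟩
      · by_contra h1
        exact h i j (Or.inl hj.symm) ⟨hi, (key j).2 h1⟩
      · by_contra h1
        exact h i i (Or.inr h1) ⟨hi, hi⟩
    · left
      have h1 : r.idem = 0 := by
        refine D.eq_zero_of_forall_mem_blockNil hB r.idem_mul_idem fun i => ?_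
        by_contra h2
        exact h0 ⟨i, (key i).2 h2⟩
      rwa [h1, add_zero] at hunit

/-- The codimension is at least two, because another subspace lies strictly between it and `End(W)`:
`blockNil hB i` itself if `i ≠ j`, and the sum of this ideal with the scalars if it is not of real
type. -/
theorem Decomposition.finrank_inf_add_two_le
    (hB : ∀ i, (B i).Indecomposable) (hn : ∀ i j, i ≠ j → ¬ (B i).IsIsomorphic (B j))
    {i j : ι}
    (hij : i ≠ j ∨ ¬ IsRealType (D.blockNil hB i)) :
    Module.finrank ℝ ↥(D.blockNil hB i ⊓ D.blockNil hB j) + 2 ≤ Module.finrank ℝ A.endo := by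
  have hP := D.isCompletelyPrime_blockNil hB hn
  have key : ∀ K K' : Submodule ℝ A.endo, K < K' → K' < ⊤ →
      Module.finrank ℝ K + 2 ≤ Module.finrank ℝ A.endo := by
    intro K K' h1 h2
    have h3 := Submodule.finrank_lt_finrank_of_lt h1
    have h4 := Submodule.finrank_lt h2.ne
    omega
  by_cases h : i = j
  · subst h
    have hr := hij.resolve_left (fun h => h rfl)
    rw [inf_idem]
    refine key _ (D.blockNil hB i ⊔ Submodule.span ℝ {1}) ?_ ?_
    · refine lt_of_le_of_ne le_sup_left fun h1 => (hP i).one_notMem ?_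
      rw [h1]
      exact Submodule.mem_sup_right (Submodule.mem_span_singleton_self 1)
    · refine lt_top_iff_ne_top.2 fun h1 => hr fun x => ?_
      have hx : x ∈ D.blockNil hB i ⊔ Submodule.span ℝ {1} := h1 ▸ Submodule.mem_top
      obtain ⟨y, hy, z, hz, rfl⟩ := Submodule.mem_sup.1 hx
      obtain ⟨c, rfl⟩ := Submodule.mem_span_singleton.1 hz
      refine ⟨c, ?_⟩
      rwa [Algebra.algebraMap_eq_smul_one, add_sub_cancel_right]
  · refine key _ (D.blockNil hB i) ?_ ?_
    · refine lt_of_le_of_ne inf_le_left fun h1 => D.idem_notMem_blockNil hB j ?_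
      exact inf_eq_left.1 h1 (D.idem_mem_blockNil hB h)
    · refine lt_top_iff_ne_top.2 fun h1 => (hP i).one_notMem ?_
      rw [h1]
      exact Submodule.mem_top

end GenKer


/-! ### Small functions and curves in general position -/

section Analysis

open Set Module

/-- A compactly supported continuous function has a small multiple below any positive continuous
function. -/
theorem exists_pos_mul_abs_le {a b : ℝ} {η : ℝ → ℝ} (hη : ContinuousOn η (Ioo a b))
    (hη0 : ∀ t ∈ Ioo a b, 0 < η t) {g : ℝ → ℝ} (hg : Continuous g) {K : Set ℝ} (hK : IsCompact K)
    (hKI : K ⊆ Ioo a b) (hgK : ∀ t ∉ K, g t = 0) :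
    ∃ ε > 0, ∀ t ∈ Ioo a b, ε * |g t| ≤ η t := by
  rcases K.eq_empty_or_nonempty with rfl | hne
  · refine ⟨1, one_pos, fun t ht => ?_⟩
    rw [hgK t (notMem_empty t), abs_zero, mul_zero]
    exact (hη0 t ht).le
  obtain ⟨t₀, ht₀, hmin⟩ := hK.exists_isMinOn hne (hη.mono hKI)
  obtain ⟨t₁, -, hmax⟩ := hK.exists_isMaxOn hne hg.abs.continuousOn
  have h0 := hη0 t₀ (hKI ht₀)
  have h1 : 0 < |g t₁| + 1 := by positivity
  refine ⟨η t₀ / (|g t₁| + 1), by positivity, fun t ht => ?_⟩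
  by_cases htK : t ∈ K
  · have h2 : |g t| ≤ |g t₁| := hmax htK
    calc η t₀ / (|g t₁| + 1) * |g t| ≤ η t₀ / (|g t₁| + 1) * (|g t₁| + 1) := by gcongr; linarith
      _ = η t₀ := div_mul_cancel₀ _ h1.ne'
      _ ≤ η t := hmin htK
  · rw [hgK t htK, abs_zero, mul_zero]
    exact (hη0 t ht).le

/-- Below every positive continuous function `δ` on an open interval there is a positive function
that extends by zero to a continuously differentiable function on the line, and whose derivative is
below `δ` as well. It is a series of bump functions with rapidly decreasing coefficients. -/
theorem exists_contDiff_pos_lt {a b : ℝ} (hab : a < b) {δ : ℝ → ℝ}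
    (hδ : ContinuousOn δ (Ioo a b)) (hδ0 : ∀ t ∈ Ioo a b, 0 < δ t) :
    ∃ ρ : ℝ → ℝ, ContDiff ℝ 1 ρ ∧ (∀ t ∉ Ioo a b, ρ t = 0) ∧
      ∀ t ∈ Ioo a b, 0 < ρ t ∧ |ρ t| < δ t ∧ |deriv ρ t| < δ t := by
  set c := (a + b) / 2 with hc
  set R := (b - a) / 2 with hR
  have hR0 : 0 < R := by rw [hR]; linarith
  have hI : Ioo a b = Metric.ball c R := by
    rw [Real.ball_eq_Ioo, hc, hR]
    congr 1 <;> ring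
  let f : ℕ → ContDiffBump c := fun n =>
    { rIn := R * (1 - 1 / (n + 2))
      rOut := R * (1 - 1 / (n + 3))
      rIn_pos := by
        have : (1 : ℝ) / (n + 2) < 1 := by rw [div_lt_one (by positivity)]; linarith
        exact mul_pos hR0 (by linarith)
      rIn_lt_rOut := by
        have : (1 : ℝ) / (n + 3) < 1 / (n + 2) :=
          one_div_lt_one_div_of_lt (by positivity) (by linarith)
        exact mul_lt_mul_of_pos_left (by linarith) hR0 }
  have hout : ∀ n, (f n).rOut < R := by
    intro n
    have : (0 : ℝ) < 1 / (n + 3) := by positivity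
    have h1 : R * (1 - 1 / (n + 3)) < R * 1 := mul_lt_mul_of_pos_left (by linarith) hR0
    rwa [mul_one] at h1
  have hsub : ∀ n, Metric.closedBall c (f n).rOut ⊆ Ioo a b := fun n => by
    rw [hI]
    exact Metric.closedBall_subset_ball (hout n)
  have hsupp : ∀ n, ∀ t ∉ Metric.closedBall c (f n).rOut, f n t = 0 := fun n t ht =>
    image_eq_zero_of_notMem_tsupport (by rwa [(f n).tsupport_eq])
  have hsupp' : ∀ n, ∀ t ∉ Metric.closedBall c (f n).rOut, deriv (f n) t = 0 := fun n t ht =>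
    image_eq_zero_of_notMem_tsupport fun h => ht (by
      rw [← (f n).tsupport_eq]
      exact tsupport_deriv_subset h)
  have hC : ∀ n, ContDiff ℝ 1 (f n) := fun n => (f n).contDiff
  have hdc : ∀ n, Continuous (deriv (f n)) := fun n => (hC n).continuous_deriv le_rfl
  set η : ℝ → ℝ := fun t => min (δ t) 1
  have hηc : ContinuousOn η (Ioo a b) := hδ.inf continuousOn_const
  have hη0 : ∀ t ∈ Ioo a b, 0 < η t := fun t ht => lt_min (hδ0 t ht) one_pos
  have hε : ∀ n, ∃ ε > 0, ∀ t ∈ Ioo a b, ε * |f n t| ≤ η t ∧ ε * |deriv (f n) t| ≤ η t := by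
    intro n
    obtain ⟨ε₁, h1, h1'⟩ := exists_pos_mul_abs_le hηc hη0 (hC n).continuous
      (isCompact_closedBall _ _) (hsub n) (hsupp n)
    obtain ⟨ε₂, h2, h2'⟩ := exists_pos_mul_abs_le hηc hη0 (hdc n)
      (isCompact_closedBall _ _) (hsub n) (hsupp' n)
    refine ⟨min ε₁ ε₂, lt_min h1 h2, fun t ht => ⟨le_trans ?_ (h1' t ht), le_trans ?_ (h2' t ht)⟩⟩
    · gcongr
      exact min_le_left _ _
    · gcongr
      exact min_le_right _ _
  choose ε hε0 hε using hε
  -- The factors `(1 / 2) ^ n * (1 / 4)` have the sum `1 / 2`, which leaves room for strictness.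
  set w : ℕ → ℝ := fun n => (1 / 2) ^ n * (1 / 4) * ε n with hw
  have hw0 : ∀ n, 0 < w n := fun n => mul_pos (by positivity) (hε0 n)
  have hsum : ∀ x : ℝ, HasSum (fun n : ℕ => (1 / 2 : ℝ) ^ n * (1 / 4) * x) (x / 2) := by
    intro x
    rw [show x / 2 = 2 * (1 / 4) * x by ring]
    exact (hasSum_geometric_two.mul_right (1 / 4)).mul_right x
  have hb : ∀ n, ∀ t ∈ Ioo a b, ‖w n * f n t‖ ≤ (1 / 2) ^ n * (1 / 4) * η t := by
    intro n t ht
    rw [Real.norm_eq_abs, abs_mul, abs_of_pos (hw0 n), hw, mul_assoc ((1 / 2) ^ n * (1 / 4))]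
    exact mul_le_mul_of_nonneg_left (hε n t ht).1 (by positivity)
  have hb' : ∀ n, ∀ t ∈ Ioo a b, ‖w n * deriv (f n) t‖ ≤ (1 / 2) ^ n * (1 / 4) * η t := by
    intro n t ht
    rw [Real.norm_eq_abs, abs_mul, abs_of_pos (hw0 n), hw, mul_assoc ((1 / 2) ^ n * (1 / 4))]
    exact mul_le_mul_of_nonneg_left (hε n t ht).2 (by positivity)
  have hb1 : ∀ n t, ‖w n * deriv (f n) t‖ ≤ (1 / 2) ^ n * (1 / 4) * 1 := by
    intro n t
    by_cases ht : t ∈ Ioo a b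
    · exact (hb' n t ht).trans (mul_le_mul_of_nonneg_left (min_le_right _ _) (by positivity))
    · rw [hsupp' n t fun h => ht (hsub n h), mul_zero, norm_zero]
      positivity
  have hder : ∀ n t, HasDerivAt (fun t => w n * f n t) (w n * deriv (f n) t) t := fun n t =>
    (((hC n).differentiable one_ne_zero) t).hasDerivAt.const_mul (w n)
  have hsummable : ∀ t ∈ Ioo a b, Summable fun n => w n * f n t := fun t ht =>
    Summable.of_norm_bounded (hsum (η t)).summable fun n => hb n t ht
  have hcI : c ∈ Ioo a b := by
    rw [hI]
    exact Metric.mem_ball_self hR0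
  have hD : ∀ t, HasDerivAt (fun t => ∑' n, w n * f n t) (∑' n, w n * deriv (f n) t) t :=
    hasDerivAt_tsum (hsum 1).summable hder hb1 (hsummable c hcI)
  refine ⟨fun t => ∑' n, w n * f n t, ?_, ?_, ?_⟩
  · rw [contDiff_one_iff_deriv]
    refine ⟨fun t => (hD t).differentiableAt, ?_⟩
    rw [funext fun t => (hD t).deriv]
    exact continuous_tsum (fun n => continuous_const.mul (hdc n)) (hsum 1).summable hb1
  · intro t ht
    have h : ∀ n, w n * f n t = 0 := fun n => by
      rw [hsupp n t fun h => ht (hsub n h), mul_zero]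
    simp [h]
  · intro t ht
    have hη1 : η t / 2 < δ t := by
      have := hη0 t ht
      have h2 : η t ≤ δ t := min_le_left _ _
      linarith
    refine ⟨?_, ?_, ?_⟩
    · obtain ⟨n, hn⟩ : ∃ n : ℕ, dist t c < (f n).rOut := by
        have h1 : dist t c < R := by
          rw [hI] at ht
          exact ht
        obtain ⟨n, hn⟩ := exists_nat_one_div_lt (div_pos (sub_pos.2 h1) hR0)
        refine ⟨n, ?_⟩
        have h2 : (1 : ℝ) / (n + 3) < (R - dist t c) / R :=
          lt_of_le_of_lt (one_div_le_one_div_of_le (by positivity) (by linarith)) hn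
        rw [lt_div_iff₀ hR0] at h2
        change dist t c < R * (1 - 1 / (n + 3))
        linarith
      refine (hsummable t ht).tsum_pos (fun n => mul_nonneg (hw0 n).le (f n).nonneg) n ?_
      exact mul_pos (hw0 n) ((f n).pos_of_mem_ball hn)
    · exact (tsum_of_norm_bounded (hsum (η t)) fun n => hb n t ht).trans_lt hη1
    · rw [(hD t).deriv]
      exact (tsum_of_norm_bounded (hsum (η t)) fun n => hb' n t ht).trans_lt hη1

/-- A translate of a `C^1` curve by a small multiple of a fixed function avoids finitely many
subspaces of codimension at least two. The directions to be excluded for a subspace `V` are the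
values of the `C^1` map `(v, t) ↦ v - γ t / ρ t` on `V × I`, a set of Hausdorff dimension at most
`dim V + 1`, so that a dense set of directions remains. -/
theorem exists_forall_add_smul_notMem {X ι : Type*} [NormedAddCommGroup X] [NormedSpace ℝ X]
    [FiniteDimensional ℝ X] [Finite ι] (V : ι → Submodule ℝ X)
    (hV : ∀ i, finrank ℝ (V i) + 2 ≤ finrank ℝ X) {I : Set ℝ} (hI : Convex ℝ I) {γ : ℝ → X}
    (hγ : ContDiffOn ℝ 1 γ I) {ρ : ℝ → ℝ} (hρ : ContDiffOn ℝ 1 ρ I) (hρ0 : ∀ t ∈ I, ρ t ≠ 0) :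
    ∃ c : X, ‖c‖ < 1 ∧ ∀ t ∈ I, ∀ i, γ t + ρ t • c ∉ V i := by
  let f : ∀ i, V i × ℝ → X := fun i p => (p.1 : X) - (ρ p.2)⁻¹ • γ p.2
  have hf : ∀ i, dimH (f i '' (univ ×ˢ I)) < finrank ℝ X := by
    intro i
    have hsm : ContDiffOn ℝ 1 (f i) (univ ×ˢ I) := by
      have hmaps : MapsTo (Prod.snd : V i × ℝ → ℝ) (univ ×ˢ I) I := fun p hp => hp.2
      refine ContDiffOn.sub ((V i).subtypeL.contDiff.comp contDiff_fst).contDiffOn ?_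
      exact ((hρ.inv hρ0).smul hγ).comp contDiff_snd.contDiffOn hmaps
    calc dimH (f i '' (univ ×ˢ I)) ≤ dimH (univ ×ˢ I : Set (V i × ℝ)) :=
          hsm.dimH_image_le (convex_univ.prod hI) Subset.rfl
      _ ≤ dimH (univ : Set (V i × ℝ)) := dimH_mono (subset_univ _)
      _ = finrank ℝ (V i × ℝ) := Real.dimH_univ_eq_finrank _
      _ < finrank ℝ X := by
        rw [finrank_prod, finrank_self]
        have := hV i
        exact_mod_cast (by omega : finrank ℝ (V i) + 1 < finrank ℝ X)
  have hdense : Dense (⋃ i, f i '' (univ ×ˢ I))ᶜ := by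
    rcases isEmpty_or_nonempty ι with h | h
    · simp
    apply dense_compl_of_dimH_lt_finrank
    rw [dimH_iUnion]
    obtain ⟨i, hi⟩ := exists_eq_ciSup_of_finite (f := fun i => dimH (f i '' (univ ×ˢ I)))
    rw [← hi]
    exact hf i
  obtain ⟨c, hc, hcball⟩ := hdense.inter_open_nonempty _ Metric.isOpen_ball
    ⟨0, Metric.mem_ball_self (one_pos : (0 : ℝ) < 1)⟩
  rw [mem_ball_zero_iff] at hc
  refine ⟨c, hc, fun t ht i hti => hcball ?_⟩
  refine mem_iUnion.2 ⟨i, (⟨_, (V i).smul_mem (ρ t)⁻¹ hti⟩, t), ⟨mem_univ _, ht⟩, ?_⟩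
  simp [f, smul_add, smul_smul, inv_mul_cancel₀ (hρ0 t ht)]

end Analysis

/-! ### Families that avoid subspaces -/

section Families

open Set Module

variable {S W : Type*} [Semigroup S] [NormedAddCommGroup W] [NormedSpace ℝ W]
  {A : SemigroupRep S W} {a b : ℝ}

/-- The families that avoid a closed set form an open set in the strong topology: the distance to
the closed set serves as the function `δ`. -/
theorem C1Family.isOpen_setOf_forall_notMem {Z : Set (W →L[ℝ] W)} (hZ : IsClosed Z) :
    IsOpen {L : C1Family A a b | ∀ t ∈ Ioo a b, L.toFun t ∉ Z} := by
  intro L hL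
  rcases Z.eq_empty_or_nonempty with rfl | hne
  · exact ⟨fun _ => 1, continuousOn_const, fun _ _ => one_pos, fun M _ t _ => notMem_empty _⟩
  refine ⟨fun t => Metric.infDist (L.toFun t) Z,
    (Metric.continuous_infDist_pt Z).comp_continuousOn L.contDiffOn.continuousOn,
    fun t ht => (hZ.notMem_iff_infDist_pos hne).1 (hL t ht), ?_⟩
  intro M hM t ht hMZ
  have h := (hM t ht).1
  rw [← dist_eq_norm, dist_comm] at h
  exact absurd (Metric.infDist_le_dist_of_mem hMZ) (not_le.2 h)

variable [FiniteDimensional ℝ W]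

/-- The embedding of `End(W)` into the normed space of continuous linear maps. -/
noncomputable def endoToCLM (A : SemigroupRep S W) : A.endo →ₗ[ℝ] W →L[ℝ] W :=
  LinearMap.toContinuousLinearMap.toLinearMap ∘ₗ A.endo.toSubmodule.subtype

theorem endoToCLM_injective (A : SemigroupRep S W) : Function.Injective A.endoToCLM :=
  LinearMap.toContinuousLinearMap.injective.comp Subtype.val_injective

theorem endoToCLM_mk {T : W →L[ℝ] W} (hT : (T : Module.End ℝ W) ∈ A.endo) :
    A.endoToCLM ⟨T, hT⟩ = T := by
  ext w
  rfl

/-- The families that avoid finitely many subspaces of codimension at least two are dense: a family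
`L` can be replaced by `L + ρ • c` with a constant `c` and a rapidly decaying function `ρ`. -/
theorem C1Family.dense_setOf_forall_notMem (hab : a < b) {ι : Type*} [Finite ι]
    (N : ι → Submodule ℝ A.endo) (hN : ∀ i, finrank ℝ (N i) + 2 ≤ finrank ℝ A.endo) :
    Dense {L : C1Family A a b | ∀ t (ht : t ∈ Ioo a b), ∀ i,
      (⟨L.toFun t, L.mem_endo t ht⟩ : A.endo) ∉ N i} := by
  rw [dense_iff_inter_open]
  rintro O hO ⟨L, hLO⟩
  obtain ⟨δ, hδ, hδ0, hδO⟩ := hO L hLO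
  obtain ⟨ρ, hρ, hρout, hρin⟩ := exists_contDiff_pos_lt hab hδ hδ0
  -- All curves are moved to the normed space `E`, the copy of `End(W)` in `W →L[ℝ] W`.
  let E := LinearMap.range A.endoToCLM
  let e : A.endo ≃ₗ[ℝ] E := LinearEquiv.ofInjective _ A.endoToCLM_injective
  obtain ⟨p, hp⟩ := LinearMap.exists_leftInverse_of_injective E.subtype (Submodule.ker_subtype _)
  have hpE : ∀ x, p (A.endoToCLM x) = e x := fun x => LinearMap.congr_fun hp (e x)
  let pc : (W →L[ℝ] W) →L[ℝ] E := ⟨p, p.continuous_of_finiteDimensional⟩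
  have hpc : ContDiff ℝ 1 pc := by fun_prop
  obtain ⟨c, hc, hcN⟩ := exists_forall_add_smul_notMem (X := E) (fun i => (N i).map e.toLinearMap)
    (fun i => by rw [LinearEquiv.finrank_map_eq, ← e.finrank_eq]; exact hN i)
    (convex_Ioo a b)
    (hpc.comp_contDiffOn L.contDiffOn)
    hρ.contDiffOn (fun t ht => (hρin t ht).1.ne')
  have hcE : ((c : W →L[ℝ] W) : Module.End ℝ W) ∈ A.endo := by
    obtain ⟨x, hx⟩ := c.2
    rw [← hx]
    exact x.2
  have hdiff : ∀ t ∈ Ioo a b, DifferentiableAt ℝ L.toFun t := fun t ht =>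
    (L.contDiffOn.differentiableOn one_ne_zero).differentiableAt (isOpen_Ioo.mem_nhds ht)
  let M : C1Family A a b :=
    { toFun := fun t => L.toFun t + ρ t • (c : W →L[ℝ] W)
      contDiffOn := L.contDiffOn.add (hρ.smul contDiff_const).contDiffOn
      mem_endo := fun t ht => A.endo.add_mem (L.mem_endo t ht) (A.endo.smul_mem hcE (ρ t))
      eq_zero := fun t ht => by rw [L.eq_zero t ht, hρout t ht, zero_smul, add_zero] }
  have hc' : ‖(c : W →L[ℝ] W)‖ ≤ 1 := hc.le
  refine ⟨M, hδO fun t ht => ?_, fun t ht i hti => hcN t ht i ⟨_, hti, ?_⟩⟩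
  · have hM : HasDerivAt M.toFun (deriv L.toFun t + deriv ρ t • (c : W →L[ℝ] W)) t :=
      (hdiff t ht).hasDerivAt.add
        ((hρ.differentiable one_ne_zero t).hasDerivAt.smul_const (c : W →L[ℝ] W))
    obtain ⟨-, h1, h2⟩ := hρin t ht
    have h0 : ∀ (T : W →L[ℝ] W) (x : ℝ), |x| < δ t → ‖T + x • (c : W →L[ℝ] W) - T‖ < δ t := by
      intro T x hx
      rw [add_sub_cancel_left, norm_smul, Real.norm_eq_abs]
      exact (mul_le_of_le_one_right (abs_nonneg _) hc').trans_lt hx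
    rw [hM.deriv]
    exact ⟨h0 _ _ h1, h0 _ _ h2⟩
  · have h1 : p (M.toFun t) = e ⟨M.toFun t, M.mem_endo t ht⟩ := by
      rw [← hpE, endoToCLM_mk]
    have h2 : p (c : W →L[ℝ] W) = c := LinearMap.congr_fun hp c
    change e ⟨M.toFun t, M.mem_endo t ht⟩ = p (L.toFun t) + ρ t • c
    rw [← h1]
    change p (L.toFun t + ρ t • (c : W →L[ℝ] W)) = _
    rw [map_add, map_smul, h2]

end Families

end SemigroupRep

theorem mainTheorem2 {S W : Type*} [Semigroup S] [NormedAddCommGroup W] [NormedSpace ℝ W]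
    [FiniteDimensional ℝ W] (A : SemigroupRep S W)
    (m : ℕ) (U : Fin m → Submodule ℝ W) (hU : ∀ i, A.IsSubrep (U i))
    (hsum : DirectSum.IsInternal U)
    (hindec : ∀ i, (A.restrict (U i) (hU i)).Indecomposable)
    (hniso : ∀ i j, i ≠ j →
      ¬ (A.restrict (U i) (hU i)).IsIsomorphic (A.restrict (U j) (hU j)))
    (a b : ℝ) (hab : a < b) :
    IsOpen {L : SemigroupRep.C1Family A a b | L.InGeneralPosition} ∧
      Dense {L : SemigroupRep.C1Family A a b | L.InGeneralPosition} := by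
  let D := SemigroupRep.Decomposition.ofIsInternal A U hU hsum
  let N := D.blockNil hindec
  -- The subspaces that a family in general position has to avoid.
  let P := {p : Fin m × Fin m // p.1 ≠ p.2 ∨ ¬ SemigroupRep.IsRealType (N p.1)}
  let Y : P → Submodule ℝ A.endo := fun p => N p.1.1 ⊓ N p.1.2
  have hgp : ∀ L : SemigroupRep.C1Family A a b, L.InGeneralPosition ↔
      ∀ t (ht : t ∈ Set.Ioo a b), ∀ p, (⟨L.toFun t, L.mem_endo t ht⟩ : A.endo) ∉ Y p := by
    intro L
    refine forall₂_congr fun t ht => ?_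
    refine (D.isUnit_or_absolutelyIndecomposable_genKer_iff hindec hniso
      ⟨L.toFun t, L.mem_endo t ht⟩).trans ?_
    exact ⟨fun h p => h p.1.1 p.1.2 p.2, fun h i j hij => h ⟨(i, j), hij⟩⟩
  constructor
  · have hZ : IsClosed (⋃ p, ((Y p).map A.endoToCLM : Set (W →L[ℝ] W))) :=
      isClosed_iUnion_of_finite fun p => Submodule.closed_of_finiteDimensional _
    convert SemigroupRep.C1Family.isOpen_setOf_forall_notMem (A := A) (a := a) (b := b) hZ
      using 1
    ext L
    refine (hgp L).trans (forall₂_congr fun t ht => ?_)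
    rw [Set.mem_iUnion, not_exists]
    refine forall_congr' fun p => not_congr ?_
    exact (A.endoToCLM_injective.mem_set_image (s := (Y p : Set A.endo))).symm
  · convert SemigroupRep.C1Family.dense_setOf_forall_notMem (A := A) hab Y
      (fun p => D.finrank_inf_add_two_le hindec hniso p.2) using 1
    ext L
    exact hgp L
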